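/- A loop $Q$ is a set with a binary operation all of whose translations $L_x(y)=xy$, $R_x(y)=yx$ are bijections and which has a neutral element $1$; write $x\backslash y=L_x^{-1}(y)$ and $y/x=R_x^{-1}(y)$. A polynomial over $Q$ is a term in $\cdot,\backslash,/,1$ involving variables and constants from $Q$. The loop $Q$ is called Boolean complete if there are two distinct elements $e_0,e_1\in Q$ such that for every $n\ge 0$ and every Boolean function $f:\{0,1\}^n\to\{0,1\}$ there is a polynomial $p$ over $Q$ in $n$ variables with $p(e_{x_1},\dots,e_{x_n})=e_{f(x_1,\dots,x_n)}$ for all $x\in\{0,1\}^n$. A normal subloop is the kernel of a loop homomorphism; a normal subloop $A$ of $Q$ corresponds to the congruence $x\sim_A y\iff x/y\in A$. For congruences $\alpha,\beta$ of $Q$, the (Freese--McKenzie) commutator $[\alpha,\beta]$ is the smallest congruence $\delta$ such that, for every loop term $t(\bar x,\bar y)$ and all tuples $\bar a,\bar b$ congruent coordinatewise modulo $\alpha$ and $\bar c,\bar d$ congruent coordinatewise modulo $\beta$, $t(\bar a,\bar c)\mathrel{\delta}t(\bar a,\bar d)$ implies $t(\bar b,\bar c)\mathrel{\delta}t(\bar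 b,\bar d)$. A normal subloop $A$ is abelian in $Q$ if $[A,A]_Q=1$, where $[A,A]_Q$ is the class of $1$ modulo $[\sim_A,\sim_A]$. The loop $Q$ is congruence solvable if there is a series $1=A_0\le A_1\le\cdots\le A_n=Q$ of normal subloops of $Q$ such that every factor $A_{i+1}/A_i$ is abelian in $Q/A_i$. Theorem. A finite loop is Boolean complete if and only if it is not congruence solvable. Moreover, the implication that a Boolean complete loop is not congruence solvable holds for all loops, finite or infinite. -/

import Mathlib

universe u v

/-- A loop: a set with a multiplication all of whose translations are bijections, and with a neutral
element. The inverses of the translations are recorded as the two divisions: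
`ldiv x y` is `x \ y`, the solution `z` of `x * z = y`, and
`rdiv y x` is `y / x`, the solution `z` of `z * x = y`. -/
class Loop (Q : Type u) extends MulOneClass Q where
  ldiv : Q → Q → Q
  rdiv : Q → Q → Q
  mul_ldiv : ∀ x y : Q, x * ldiv x y = y
  ldiv_mul : ∀ x y : Q, ldiv x (x * y) = y
  rdiv_mul : ∀ x y : Q, rdiv y x * x = y
  mul_rdiv : ∀ x y : Q, rdiv (y * x) x = y

namespace Loop

section Basic

variable {Q : Type u} [Loop Q] {L : Type v} [Loop L]

theorem map_ldiv (f : Q →* L) (x y : Q) : f (ldiv x y) = ldiv (f x) (f y) := by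
  rw [← ldiv_mul (f x) (f (ldiv x y)), ← map_mul, mul_ldiv]

theorem map_rdiv (f : Q →* L) (x y : Q) : f (rdiv x y) = rdiv (f x) (f y) := by
  rw [← mul_rdiv (f y) (f (rdiv x y)), ← map_mul, rdiv_mul]

theorem rdiv_eq_one_iff {x y : Q} : rdiv x y = 1 ↔ x = y := by
  constructor
  · intro h
    have h2 := rdiv_mul y x
    rw [h, one_mul] at h2
    exact h2.symm
  · rintro rfl
    have h2 := mul_rdiv x 1
    rwa [one_mul] at h2

theorem ldiv_one_one : ldiv (1 : Q) 1 = 1 := by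
  have h := ldiv_mul (1 : Q) 1
  rwa [one_mul] at h

theorem rdiv_one (x : Q) : rdiv x 1 = x := by
  have h := mul_rdiv (1 : Q) x
  rwa [mul_one] at h

end Basic

/-! ### Terms and polynomials -/

/-- Terms in the language of loops with variables in `X`. -/
inductive LoopTerm (X : Type u) : Type u
  | var : X → LoopTerm X
  | one : LoopTerm X
  | mul : LoopTerm X → LoopTerm X → LoopTerm X
  | ldiv : LoopTerm X → LoopTerm X → LoopTerm X
  | rdiv : LoopTerm X → LoopTerm X → LoopTerm X

/-- The value of a term under an assignment of elements of a loop to the variables. -/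
def LoopTerm.eval {X : Type u} {Q : Type v} [Loop Q] (σ : X → Q) : LoopTerm X → Q
  | .var x => σ x
  | .one => 1
  | .mul s t => s.eval σ * t.eval σ
  | .ldiv s t => Loop.ldiv (s.eval σ) (t.eval σ)
  | .rdiv s t => Loop.rdiv (s.eval σ) (t.eval σ)

/-- Polynomials over a loop `Q` in the variables `x₀, …, xₙ₋₁`: loop terms in which
variables `Sum.inr i` and constants `Sum.inl q` from `Q` may occur. -/
abbrev LoopPoly (Q : Type u) (n : ℕ) : Type u := LoopTerm (Q ⊕ Fin n)

/-- The value of a polynomial at a point. -/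
def LoopPoly.value {Q : Type u} [Loop Q] {n : ℕ} (p : LoopPoly Q n) (x : Fin n → Q) : Q :=
  LoopTerm.eval (Sum.elim id x) p

/-- A loop is Boolean complete if it has two distinct elements, `e false` and `e true`, such that
every Boolean function, of every arity, is the restriction of a polynomial once the truth values are
identified with these two elements. -/
def BooleanComplete (Q : Type u) [Loop Q] : Prop :=
  ∃ e : Bool → Q, e false ≠ e true ∧
    ∀ (n : ℕ) (f : (Fin n → Bool) → Bool), ∃ p : LoopPoly Q n,
      ∀ x : Fin n → Bool, p.value (fun i => e (x i)) = e (f x)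

/-! ### Congruences and quotients -/

/-- A congruence of a loop: an equivalence relation compatible with multiplication and with both
divisions. -/
structure LoopCon (Q : Type u) [Loop Q] extends Con Q where
  ldiv' : ∀ {w x y z}, r w x → r y z → r (ldiv w y) (ldiv x z)
  rdiv' : ∀ {w x y z}, r w x → r y z → r (rdiv w y) (rdiv x z)

namespace LoopCon

variable {Q : Type u} [Loop Q]

/-- The quotient of a loop by a congruence, on which the operations are those of representatives. -/
def Quo (c : LoopCon Q) : Type u := c.toCon.Quotient

instance (c : LoopCon Q) : Loop c.Quo where
  toMulOneClass := (inferInstance : MulOneClass c.toCon.Quotient)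
  ldiv := Quotient.map₂ ldiv fun _ _ h _ _ h' => c.ldiv' h h'
  rdiv := Quotient.map₂ rdiv fun _ _ h _ _ h' => c.rdiv' h h'
  mul_ldiv := by
    rintro ⟨x⟩ ⟨y⟩
    exact congrArg (Quotient.mk c.toSetoid) (mul_ldiv x y)
  ldiv_mul := by
    rintro ⟨x⟩ ⟨y⟩
    exact congrArg (Quotient.mk c.toSetoid) (ldiv_mul x y)
  rdiv_mul := by
    rintro ⟨x⟩ ⟨y⟩
    exact congrArg (Quotient.mk c.toSetoid) (rdiv_mul x y)
  mul_rdiv := by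
    rintro ⟨x⟩ ⟨y⟩
    exact congrArg (Quotient.mk c.toSetoid) (mul_rdiv x y)

/-- The projection of a loop onto its quotient. -/
def proj (c : LoopCon Q) : Q →* c.Quo := c.toCon.mk'

theorem proj_surjective (c : LoopCon Q) : Function.Surjective c.proj := Quotient.mk_surjective

theorem proj_eq_iff (c : LoopCon Q) {x y : Q} : c.proj x = c.proj y ↔ c.r x y := Quotient.eq

/-- `α` centralizes `β` modulo `δ`: the term condition `C(α, β; δ)`. -/
def Centralizes (α β δ : LoopCon Q) : Prop :=
  ∀ (m n : ℕ) (t : LoopTerm (Fin m ⊕ Fin n)) (a b : Fin m → Q) (c d : Fin n → Q),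
    (∀ i, α.r (a i) (b i)) → (∀ j, β.r (c j) (d j)) →
      δ.r (t.eval (Sum.elim a c)) (t.eval (Sum.elim a d)) →
        δ.r (t.eval (Sum.elim b c)) (t.eval (Sum.elim b d))

/-- The commutator of two congruences: the smallest congruence modulo which `α` centralizes `β`
(the intersection of all of them). -/
def commutator (α β : LoopCon Q) : LoopCon Q where
  r x y := ∀ δ : LoopCon Q, Centralizes α β δ → δ.r x y
  iseqv :=
    ⟨fun x δ _ => δ.iseqv.refl x, fun h δ hδ => δ.iseqv.symm (h δ hδ),
      fun h h' δ hδ => δ.iseqv.trans (h δ hδ) (h' δ hδ)⟩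
  mul' h h' δ hδ := δ.mul' (h δ hδ) (h' δ hδ)
  ldiv' h h' δ hδ := δ.ldiv' (h δ hδ) (h' δ hδ)
  rdiv' h h' δ hδ := δ.rdiv' (h δ hδ) (h' δ hδ)

/-- The intersection of the congruences in question is itself one of them. -/
theorem centralizes_commutator (α β : LoopCon Q) : Centralizes α β (commutator α β) :=
  fun m n t a b c d hab hcd h δ hδ => hδ m n t a b c d hab hcd (h δ hδ)

end LoopCon

/-! ### Normal subloops -/

/-- A subloop: a subset containing `1` and closed under multiplication and both divisions. -/
@[ext]
structure Subloop (Q : Type u) [Loop Q] where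
  carrier : Set Q
  one_mem : (1 : Q) ∈ carrier
  mul_mem : ∀ {x y}, x ∈ carrier → y ∈ carrier → x * y ∈ carrier
  ldiv_mem : ∀ {x y}, x ∈ carrier → y ∈ carrier → ldiv x y ∈ carrier
  rdiv_mem : ∀ {x y}, x ∈ carrier → y ∈ carrier → rdiv x y ∈ carrier

/-- A subloop is normal if it is the kernel of a homomorphism of loops. -/
def Subloop.Normal {Q : Type u} [Loop Q] (A : Subloop Q) : Prop :=
  ∃ (L : Type u) (_ : Loop L) (f : Q →* L), A.carrier = {x | f x = 1}

/-- The kernel of a homomorphism of loops, as a subloop. -/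
def kernel {Q : Type u} [Loop Q] {L : Type v} [Loop L] (f : Q →* L) : Subloop Q where
  carrier := {x | f x = 1}
  one_mem := map_one f
  mul_mem {x y} hx hy := by
    have hx : f x = 1 := hx
    have hy : f y = 1 := hy
    simp [hx, hy]
  ldiv_mem {x y} hx hy := by
    have hx : f x = 1 := hx
    have hy : f y = 1 := hy
    simp [map_ldiv, hx, hy, ldiv_one_one]
  rdiv_mem {x y} hx hy := by
    have hx : f x = 1 := hx
    have hy : f y = 1 := hy
    simp [map_rdiv, hx, hy, rdiv_one]

/-- The type of normal subloops of a loop. -/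
@[ext]
structure NormalSubloop (Q : Type u) [Loop Q] extends Subloop Q where
  normal : toSubloop.Normal

namespace NormalSubloop

variable {Q : Type u} [Loop Q]

/-- Inclusion of normal subloops. -/
instance : LE (NormalSubloop Q) := ⟨fun A B => A.carrier ⊆ B.carrier⟩

/-- The kernel of a homomorphism of loops, as a normal subloop. -/
def ker {L : Type u} [Loop L] (f : Q →* L) : NormalSubloop Q :=
  ⟨kernel f, L, inferInstance, f, rfl⟩

/-- The trivial subloop `{1}`. -/
def trivial (Q : Type u) [Loop Q] : NormalSubloop Q := ker (MonoidHom.id Q)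

theorem carrier_trivial : (trivial Q).carrier = {1} := rfl

/-- The whole loop, as a normal subloop of itself. -/
def whole (Q : Type u) [Loop Q] : NormalSubloop Q := ker (1 : Q →* Q)

theorem carrier_whole : (whole Q).carrier = Set.univ := by
  ext x
  simp [whole, ker, kernel]

/-- If `A` is the kernel of `f`, then `x / y ∈ A` if and only if `f x = f y`. -/
theorem exists_hom (A : NormalSubloop Q) : ∃ (L : Type u) (_ : Loop L) (f : Q →* L),
    ∀ x y, rdiv x y ∈ A.carrier ↔ f x = f y := by
  obtain ⟨L, i, f, h⟩ := A.normal
  refine ⟨L, i, f, fun x y => ?_⟩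
  rw [h, Set.mem_ofPred_eq, map_rdiv, rdiv_eq_one_iff]

/-- The congruence of a normal subloop `A`: `x` and `y` are congruent if `x / y ∈ A`. -/
def con (A : NormalSubloop Q) : LoopCon Q where
  r x y := rdiv x y ∈ A.carrier
  iseqv := by
    obtain ⟨L, i, f, h⟩ := A.exists_hom
    simp only [h]
    exact ⟨fun _ => rfl, fun h => h.symm, fun h h' => h.trans h'⟩
  mul' {w x y z} := by
    obtain ⟨L, i, f, h⟩ := A.exists_hom
    intro h1 h2
    have h1 : f w = f x := (h _ _).1 h1
    have h2 : f y = f z := (h _ _).1 h2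
    exact (h _ _).2 (by rw [map_mul, map_mul, h1, h2])
  ldiv' {w x y z} := by
    obtain ⟨L, i, f, h⟩ := A.exists_hom
    intro h1 h2
    have h1 : f w = f x := (h _ _).1 h1
    have h2 : f y = f z := (h _ _).1 h2
    exact (h _ _).2 (by rw [map_ldiv, map_ldiv, h1, h2])
  rdiv' {w x y z} := by
    obtain ⟨L, i, f, h⟩ := A.exists_hom
    intro h1 h2
    have h1 : f w = f x := (h _ _).1 h1
    have h2 : f y = f z := (h _ _).1 h2
    exact (h _ _).2 (by rw [map_rdiv, map_rdiv, h1, h2])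

/-- The normal subloop of a congruence: the class of `1`. -/
def ofCon (c : LoopCon Q) : NormalSubloop Q := ker c.proj

theorem mem_ofCon (c : LoopCon Q) (x : Q) : x ∈ (ofCon c).carrier ↔ c.r x 1 :=
  c.proj_eq_iff (y := 1)

/-- The commutator `[A, B]_Q` of two normal subloops of `Q`: the normal subloop that corresponds to
the commutator of their congruences. -/
def commutator (A B : NormalSubloop Q) : NormalSubloop Q :=
  ofCon (LoopCon.commutator A.con B.con)

/-- A normal subloop `A` is abelian in `Q` if `[A, A]_Q = 1`. -/
def AbelianIn (A : NormalSubloop Q) : Prop := commutator A A = trivial Q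

/-- The quotient loop `Q / A`. -/
abbrev Quo (A : NormalSubloop Q) : Type u := A.con.Quo

/-- For normal subloops `A ≤ B` of `Q`, the homomorphism `Q / A → Q / B`. -/
def quoMap {A B : NormalSubloop Q} (h : A ≤ B) : A.Quo →* B.Quo where
  toFun := Quotient.map' (s₁ := A.con.toSetoid) (s₂ := B.con.toSetoid) id fun _ _ hxy => h hxy
  map_one' := rfl
  map_mul' := by
    rintro ⟨x⟩ ⟨y⟩
    rfl

/-- For normal subloops `A ≤ B` of `Q`, the factor `B / A` as a normal subloop of `Q / A`. -/
def factor {A B : NormalSubloop Q} (h : A ≤ B) : NormalSubloop A.Quo := ker (quoMap h)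

/-- The factor `B / A` consists of the classes modulo `A` of the elements of `B`. -/
theorem carrier_factor {A B : NormalSubloop Q} (h : A ≤ B) :
    (factor h).carrier = A.con.proj '' B.carrier := by
  have key : ∀ x : Q, A.con.proj x ∈ (factor h).carrier ↔ x ∈ B.carrier := fun x => by
    have h1 : A.con.proj x ∈ (factor h).carrier ↔ B.con.r x 1 := B.con.proj_eq_iff (y := 1)
    have h2 : B.con.r x 1 ↔ rdiv x 1 ∈ B.carrier := Iff.rfl
    rw [h1, h2, rdiv_one]
  ext q
  constructor
  · intro hq
    obtain ⟨x, rfl⟩ := A.con.proj_surjective q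
    exact ⟨x, (key x).1 hq, rfl⟩
  · rintro ⟨x, hx, rfl⟩
    exact (key x).2 hx

end NormalSubloop

/-- A loop `Q` is congruence solvable if there is a series `1 = A₀ ≤ A₁ ≤ ⋯ ≤ Aₙ = Q` of normal
subloops of `Q` such that every factor `Aᵢ₊₁ / Aᵢ` is abelian in `Q / Aᵢ`. -/
def CongruenceSolvable (Q : Type u) [Loop Q] : Prop :=
  ∃ (n : ℕ) (A : ℕ → NormalSubloop Q),
    A 0 = NormalSubloop.trivial Q ∧ A n = NormalSubloop.whole Q ∧
      ∀ i < n, ∃ h : A i ≤ A (i + 1), (NormalSubloop.factor h).AbelianIn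

end Loop

/-! Boolean completeness amounts to finding `e ≠ 1` and a polynomial conjunction on `{1, e}`, since
`x ↦ x \ e` is a negation (`booleanComplete_of_and`).

If a finite loop is not congruence solvable, some covering pair `δ ⋖ β` of congruences violates the
term condition `C(β, β; δ)`, for otherwise a maximal chain of congruences is a solvable series. As
loops have a Mal'tsev term, the violation can be rewritten as a binary polynomial on `{1, u}`, and
loop differences turn it into `p` with `p 1 y = p x 1 = 1` and `p u u` not `δ`-congruent to `1`.
Because `β` covers `δ`, a unary polynomial fixing `1` carries `p u u` back to `u` modulo `δ`.
Iterating `x ↦ p x x`, which is eventually periodic, makes this conjunction exact.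

Conversely, in any loop, a conjunction on a `β`-congruent pair contradicts the term condition modulo
`δ` unless the pair is already `δ`-congruent. The two truth values therefore stay apart all the way
up a solvable series, whose top identifies everything. -/

namespace Loop

/-! ### Terms: renaming, finitely many variables, homomorphisms and congruences -/

section Terms

variable {Q : Type u} [Loop Q]

/-- Renaming of the variables of a term. -/
def LoopTerm.map {X : Type*} {Y : Type*} (g : X → Y) : LoopTerm X → LoopTerm Y
  | .var x => .var (g x)
  | .one => .one
  | .mul s t => .mul (s.map g) (t.map g)
  | .ldiv s t => .ldiv (s.map g) (t.map g)
  | .rdiv s t => .rdiv (s.map g) (t.map g)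

theorem LoopTerm.eval_map {X : Type*} {Y : Type*} (g : X → Y) (σ : Y → Q) (t : LoopTerm X) :
    (t.map g).eval σ = t.eval (σ ∘ g) := by
  induction t with
  | var x => rfl
  | one => rfl
  | mul s t hs ht => simp only [map, eval, hs, ht]
  | ldiv s t hs ht => simp only [map, eval, hs, ht]
  | rdiv s t hs ht => simp only [map, eval, hs, ht]

theorem LoopTerm.map_map {X : Type*} {Y : Type*} {Z : Type*} (g : X → Y) (h : Y → Z)
    (t : LoopTerm X) : (t.map g).map h = t.map (h ∘ g) := by
  induction t with
  | var x => rfl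
  | one => rfl
  | mul s t hs ht => simp only [map, hs, ht]
  | ldiv s t hs ht => simp only [map, hs, ht]
  | rdiv s t hs ht => simp only [map, hs, ht]

/-- Two terms can be written with variables from a common finite list. -/
theorem LoopTerm.exists_fin_pair {X : Type*} {m n : ℕ} (s : LoopTerm (Fin m)) (g : Fin m → X)
    (t : LoopTerm (Fin n)) (h : Fin n → X) :
    ∃ (k : ℕ) (s' t' : LoopTerm (Fin k)) (l : Fin k → X), s'.map l = s.map g ∧ t'.map l = t.map h := by
  refine ⟨m + n, s.map (Fin.castAdd n), t.map (Fin.natAdd m), Fin.append g h, ?_, ?_⟩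
  · rw [map_map]; congr 1; funext i; simp
  · rw [map_map]; congr 1; funext i; simp

/-- A term contains only finitely many variables. -/
theorem LoopTerm.exists_fin {X : Type*} (t : LoopTerm X) :
    ∃ (m : ℕ) (s : LoopTerm (Fin m)) (g : Fin m → X), s.map g = t := by
  induction t with
  | var x => exact ⟨1, .var 0, fun _ => x, rfl⟩
  | one => exact ⟨0, .one, Fin.elim0, rfl⟩
  | mul s t hs ht =>
    obtain ⟨m, s, g, rfl⟩ := hs
    obtain ⟨n, t, h, rfl⟩ := ht
    obtain ⟨k, s', t', l, hs, ht⟩ := exists_fin_pair s g t h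
    exact ⟨k, .mul s' t', l, by rw [← hs, ← ht]; rfl⟩
  | ldiv s t hs ht =>
    obtain ⟨m, s, g, rfl⟩ := hs
    obtain ⟨n, t, h, rfl⟩ := ht
    obtain ⟨k, s', t', l, hs, ht⟩ := exists_fin_pair s g t h
    exact ⟨k, .ldiv s' t', l, by rw [← hs, ← ht]; rfl⟩
  | rdiv s t hs ht =>
    obtain ⟨m, s, g, rfl⟩ := hs
    obtain ⟨n, t, h, rfl⟩ := ht
    obtain ⟨k, s', t', l, hs, ht⟩ := exists_fin_pair s g t h
    exact ⟨k, .rdiv s' t', l, by rw [← hs, ← ht]; rfl⟩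

theorem LoopTerm.map_eval {L : Type*} [Loop L] {X : Type*} (f : Q →* L) (σ : X → Q)
    (t : LoopTerm X) : f (t.eval σ) = t.eval (f ∘ σ) := by
  induction t with
  | var x => rfl
  | one => exact map_one f
  | mul s t hs ht => simp only [eval, map_mul, hs, ht]
  | ldiv s t hs ht => simp only [eval, map_ldiv, hs, ht]
  | rdiv s t hs ht => simp only [eval, map_rdiv, hs, ht]

theorem LoopCon.eval_rel (c : LoopCon Q) {X : Type*} {σ τ : X → Q} (h : ∀ x, c.r (σ x) (τ x))
    (t : LoopTerm X) : c.r (t.eval σ) (t.eval τ) := by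
  induction t with
  | var x => exact h x
  | one => exact c.iseqv.refl _
  | mul s t hs ht => exact c.mul' hs ht
  | ldiv s t hs ht => exact c.ldiv' hs ht
  | rdiv s t hs ht => exact c.rdiv' hs ht

end Terms

/-! ### Polynomial functions and their closure under composition -/

section Polynomials

variable {Q : Type u} [Loop Q] {n : ℕ}

/-- A function is polynomial if it is the function of some polynomial. -/
def IsPoly (F : (Fin n → Q) → Q) : Prop := ∃ p : LoopPoly Q n, ∀ x, p.value x = F x

namespace IsPoly

theorem const (q : Q) : IsPoly fun _ : Fin n → Q => q := ⟨.var (.inl q), fun _ => rfl⟩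

theorem proj (i : Fin n) : IsPoly fun x : Fin n → Q => x i := ⟨.var (.inr i), fun _ => rfl⟩

theorem mul {F G : (Fin n → Q) → Q} : IsPoly F → IsPoly G → IsPoly fun x => F x * G x := by
  rintro ⟨p, hp⟩ ⟨q, hq⟩
  exact ⟨.mul p q, fun x => congrArg₂ _ (hp x) (hq x)⟩

theorem ldiv {F G : (Fin n → Q) → Q} :
    IsPoly F → IsPoly G → IsPoly fun x => Loop.ldiv (F x) (G x) := by
  rintro ⟨p, hp⟩ ⟨q, hq⟩
  exact ⟨.ldiv p q, fun x => congrArg₂ _ (hp x) (hq x)⟩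

theorem rdiv {F G : (Fin n → Q) → Q} :
    IsPoly F → IsPoly G → IsPoly fun x => Loop.rdiv (F x) (G x) := by
  rintro ⟨p, hp⟩ ⟨q, hq⟩
  exact ⟨.rdiv p q, fun x => congrArg₂ _ (hp x) (hq x)⟩

theorem eval {X : Type*} {F : X → (Fin n → Q) → Q} (hF : ∀ i, IsPoly (F i)) (t : LoopTerm X) :
    IsPoly fun x => t.eval fun i => F i x := by
  induction t with
  | var x => exact hF x
  | one => exact const 1
  | mul s t hs ht => exact hs.mul ht
  | ldiv s t hs ht => exact hs.ldiv ht
  | rdiv s t hs ht => exact hs.rdiv ht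

theorem comp {m : ℕ} {F : (Fin m → Q) → Q} (hF : IsPoly F) {G : Fin m → (Fin n → Q) → Q}
    (hG : ∀ i, IsPoly (G i)) : IsPoly fun x => F fun i => G i x := by
  obtain ⟨p, hp⟩ := hF
  have h := eval (F := Sum.elim (fun q _ => q) G) (fun i => by
    rcases i with q | i
    · exact const q
    · exact hG i) p
  convert h using 2 with x
  rw [← hp]
  unfold LoopPoly.value
  congr 1
  funext i
  rcases i with q | i <;> rfl

end IsPoly

/-- Unary polynomial functions. -/
def IsPoly₁ (f : Q → Q) : Prop := IsPoly fun x : Fin 1 → Q => f (x 0)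

/-- Binary polynomial functions. -/
def IsPoly₂ (f : Q → Q → Q) : Prop := IsPoly fun x : Fin 2 → Q => f (x 0) (x 1)

theorem IsPoly₁.comp {f : Q → Q} (hf : IsPoly₁ f) {G : (Fin n → Q) → Q} (hG : IsPoly G) :
    IsPoly fun x => f (G x) :=
  IsPoly.comp hf fun _ => hG

theorem IsPoly₂.comp {f : Q → Q → Q} (hf : IsPoly₂ f) {G H : (Fin n → Q) → Q} (hG : IsPoly G)
    (hH : IsPoly H) : IsPoly fun x => f (G x) (H x) :=
  IsPoly.comp (G := ![G, H]) hf (fun i => by fin_cases i <;> assumption)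

theorem IsPoly₁.iterate {f : Q → Q} (hf : IsPoly₁ f) (k : ℕ) : IsPoly₁ f^[k] := by
  induction k with
  | zero => exact IsPoly.proj 0
  | succ k ih => exact ih.comp hf

theorem IsPoly₁.rel {f : Q → Q} (hf : IsPoly₁ f) (c : LoopCon Q) {x y : Q} (h : c.r x y) :
    c.r (f x) (f y) := by
  obtain ⟨p, hp⟩ := hf
  suffices h : c.r (p.value fun _ => x) (p.value fun _ => y) by rwa [hp, hp] at h
  refine c.eval_rel (fun i => ?_) p
  rcases i with q | i
  · exact c.iseqv.refl _
  · exact h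

end Polynomials

/-! ### Boolean completeness from a polynomial conjunction -/

/-- Shannon expansion, by induction on a finite set of variables that determines `f`. -/
theorem exists_isPoly_of_and {Q : Type u} [Loop Q] {p : Q → Q → Q} (hp : IsPoly₂ p) {e : Q}
    (h0 : ∀ y, p 1 y = 1) (h1 : ∀ x, p x 1 = 1) (he : p e e = e) {n : ℕ}
    (f : (Fin n → Bool) → Bool) :
    ∃ F : (Fin n → Q) → Q, IsPoly F ∧
      ∀ x : Fin n → Bool, F (fun i => bif x i then e else 1) = bif f x then e else 1 := by
  suffices H : ∀ (s : Finset (Fin n)) (f : (Fin n → Bool) → Bool),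
      (∀ x y, (∀ i ∈ s, x i = y i) → f x = f y) → ∃ F : (Fin n → Q) → Q, IsPoly F ∧
        ∀ x : Fin n → Bool, F (fun i => bif x i then e else 1) = bif f x then e else 1 by
    exact H Finset.univ f fun x y h => congrArg f (funext fun i => h i (Finset.mem_univ i))
  intro s
  induction s using Finset.induction with
  | empty =>
    intro f hf
    refine ⟨_, IsPoly.const (bif f (fun _ => false) then e else 1), fun x => ?_⟩
    rw [hf x (fun _ => false) (by simp)]
  | insert i s _ ih =>
    intro f hf
    have hstep : ∀ b : Bool, ∃ F : (Fin n → Q) → Q, IsPoly F ∧ ∀ x : Fin n → Bool,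
        F (fun i => bif x i then e else 1) = bif f (Function.update x i b) then e else 1 := by
      intro b
      refine ih (fun x => f (Function.update x i b)) fun x y h => hf _ _ fun j hj => ?_
      by_cases hji : j = i
      · subst hji; simp
      · simp [Function.update_of_ne hji, h j ((Finset.mem_insert.1 hj).resolve_left hji)]
    obtain ⟨F, hF, hFv⟩ := hstep false
    obtain ⟨G, hG, hGv⟩ := hstep true
    have hnot : IsPoly₁ fun x : Q => ldiv x e := (IsPoly.proj 0).ldiv (IsPoly.const e)
    -- This is `¬(¬(xᵢ ∧ G) ∧ ¬(¬xᵢ ∧ F))`, that is, "if `xᵢ` then `G` else `F`".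
    refine ⟨_, hnot.comp (hp.comp (hnot.comp (hp.comp (IsPoly.proj i) hG))
      (hnot.comp (hp.comp (hnot.comp (IsPoly.proj i)) hF))), fun x => ?_⟩
    have n1 : ldiv 1 e = e := by have h := ldiv_mul 1 e; rwa [one_mul] at h
    have n2 : ldiv e e = 1 := by have h := ldiv_mul e 1; rwa [mul_one] at h
    simp only [hFv, hGv]
    cases hx : x i
    · have hu : Function.update x i false = x := by rw [← hx, Function.update_eq_self]
      rw [hu]
      cases f x <;> simp [h0, he, h1, n1, n2]
    · have hu : Function.update x i true = x := by rw [← hx, Function.update_eq_self]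
      rw [hu]
      cases f x <;> simp [h0, he, h1, n1, n2]

theorem booleanComplete_of_and {Q : Type u} [Loop Q] {p : Q → Q → Q} (hp : IsPoly₂ p) {e : Q}
    (hne : e ≠ 1) (h0 : ∀ y, p 1 y = 1) (h1 : ∀ x, p x 1 = 1) (he : p e e = e) :
    BooleanComplete Q := by
  refine ⟨fun b => bif b then e else 1, hne.symm, fun n f => ?_⟩
  obtain ⟨F, ⟨q, hq⟩, hF⟩ := exists_isPoly_of_and hp h0 h1 he f
  exact ⟨q, fun x => by rw [hq, hF]⟩

theorem rdiv_self {Q : Type u} [Loop Q] (x : Q) : rdiv x x = 1 := rdiv_eq_one_iff.2 rfl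

/-! ### The order on congruences -/

namespace LoopCon

variable {Q : Type u} [Loop Q]

theorem r_injective : Function.Injective fun c : LoopCon Q => c.r := by
  rintro ⟨⟨⟨r, _⟩, _⟩, _, _⟩ ⟨⟨⟨s, _⟩, _⟩, _, _⟩ (h : r = s)
  subst h
  rfl

instance : PartialOrder (LoopCon Q) := PartialOrder.lift _ r_injective

instance [Finite Q] : Finite (LoopCon Q) := Finite.of_injective _ r_injective

theorem rel_iff_rdiv (c : LoopCon Q) {x y : Q} : c.r x y ↔ c.r (rdiv x y) 1 := by
  rw [← proj_eq_iff, ← proj_eq_iff, map_rdiv, map_one, rdiv_eq_one_iff]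

/-- For a congruence `δ` and an element `u`, the congruence generated by `δ` and `(1, u)`: as
`(x / y) * z` is a Mal'tsev term, it consists up to `δ` of the pairs of values at `1` and `u` of
unary polynomials. -/
def adjoin (δ : LoopCon Q) (u : Q) : LoopCon Q where
  r x y := ∃ f, IsPoly₁ f ∧ δ.r (f 1) x ∧ δ.r (f u) y
  iseqv := by
    have eqx : ∀ x y : Q, rdiv x x * y = y := fun x y => by rw [rdiv_self, one_mul]
    have eqy : ∀ x y : Q, rdiv x y * y = x := fun x y => rdiv_mul y x
    refine ⟨fun x => ⟨fun _ => x, IsPoly.const x, δ.iseqv.refl _, δ.iseqv.refl _⟩, ?_, ?_⟩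
    · rintro x y ⟨f, hf, h1, h2⟩
      -- The Mal'tsev term swaps the endpoints: `f z = x` gives `y`, and `f z = y` gives `x`.
      refine ⟨fun z => rdiv x (f z) * y, ((IsPoly.const x).rdiv hf).mul (IsPoly.const y), ?_, ?_⟩
      · have h := δ.mul' (δ.rdiv' (δ.iseqv.refl x) h1) (δ.iseqv.refl y)
        rwa [eqx] at h
      · have h := δ.mul' (δ.rdiv' (δ.iseqv.refl x) h2) (δ.iseqv.refl y)
        rwa [eqy] at h
    · rintro x y z ⟨f, hf, h1, h2⟩ ⟨g, hg, h3, h4⟩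
      refine ⟨fun w => rdiv (f w) y * g w, (IsPoly.rdiv hf (IsPoly.const y)).mul hg, ?_, ?_⟩
      · have h := δ.mul' (δ.rdiv' h1 (δ.iseqv.refl y)) h3
        rwa [eqy] at h
      · have h := δ.mul' (δ.rdiv' h2 (δ.iseqv.refl y)) h4
        rwa [eqx] at h
  mul' := by
    rintro w x y z ⟨f, hf, h1, h2⟩ ⟨g, hg, h3, h4⟩
    exact ⟨fun z => f z * g z, IsPoly.mul hf hg, δ.mul' h1 h3, δ.mul' h2 h4⟩
  ldiv' := by
    rintro w x y z ⟨f, hf, h1, h2⟩ ⟨g, hg, h3, h4⟩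
    exact ⟨fun z => ldiv (f z) (g z), IsPoly.ldiv hf hg, δ.ldiv' h1 h3, δ.ldiv' h2 h4⟩
  rdiv' := by
    rintro w x y z ⟨f, hf, h1, h2⟩ ⟨g, hg, h3, h4⟩
    exact ⟨fun z => rdiv (f z) (g z), IsPoly.rdiv hf hg, δ.rdiv' h1 h3, δ.rdiv' h2 h4⟩

/-- The congruence lies between `δ` and `β`, and the identity polynomial puts `(1, u)` in it, so it
is not `δ`. -/
theorem adjoin_eq {δ β : LoopCon Q} (h : δ ⋖ β) {u : Q} (hu : β.r 1 u) (hu' : ¬ δ.r 1 u) :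
    δ.adjoin u = β := by
  have h1 : δ ≤ δ.adjoin u := fun x y hxy =>
    ⟨fun _ => x, IsPoly.const x, δ.iseqv.refl x, hxy⟩
  have h2 : δ.adjoin u ≤ β := by
    rintro x y ⟨f, hf, hx, hy⟩
    exact β.iseqv.trans (β.iseqv.symm (h.le _ _ hx)) (β.iseqv.trans (hf.rel β hu) (h.le _ _ hy))
  refine (h.eq_or_eq h1 h2).resolve_left fun heq => hu' ?_
  rw [← heq]
  exact ⟨id, IsPoly.proj 0, δ.iseqv.refl _, δ.iseqv.refl _⟩

/-- If `β` covers `δ`, then every `u` that is congruent to `1` modulo `β` but not modulo `δ` is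
carried to any `v` in the `β`-class of `1`, up to `δ`, by a unary polynomial that fixes `1`. -/
theorem exists_isPoly₁ {δ β : LoopCon Q} (h : δ ⋖ β) {u v : Q} (hu : β.r 1 u) (hu' : ¬ δ.r 1 u)
    (hv : β.r 1 v) : ∃ f, IsPoly₁ f ∧ f 1 = 1 ∧ δ.r (f u) v := by
  rw [← adjoin_eq h hu hu'] at hv
  obtain ⟨f, hf, h1, h2⟩ := hv
  -- Dividing by `f 1`, which is only `δ`-congruent to `1`, makes the value at `1` exact.
  refine ⟨fun x => rdiv (f x) (f 1), IsPoly.rdiv hf (IsPoly.const _), rdiv_self _, ?_⟩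
  have h := δ.rdiv' h2 h1
  rwa [rdiv_one] at h

end LoopCon

/-! ### Finite loops -/

section Finite

variable {Q : Type u} [Loop Q]

open LoopCon

/-- A nonabelian covering of congruences yields a polynomial conjunction up to the lower one. -/
theorem LoopCon.exists_and_of_not_centralizes {δ β : LoopCon Q} (h : δ ⋖ β)
    (hC : ¬ Centralizes β β δ) : ∃ (p : Q → Q → Q) (u : Q), IsPoly₂ p ∧ ¬ δ.r 1 u ∧
      (∀ y, p 1 y = 1) ∧ (∀ x, p x 1 = 1) ∧ δ.r (p u u) u := by
  obtain ⟨u, hu, hu'⟩ : ∃ u, β.r 1 u ∧ ¬ δ.r 1 u := by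
    by_contra! hcon
    refine h.lt.not_ge fun x y hxy => ?_
    exact δ.rel_iff_rdiv.2 (δ.iseqv.symm (hcon _ (β.iseqv.symm (β.rel_iff_rdiv.1 hxy))))
  unfold Centralizes at hC
  push Not at hC
  obtain ⟨m, n, t, a, b, c, d, hab, hcd, h1, h2⟩ := hC
  -- Each pair `(a i, b i)` and `(c j, d j)` is now, up to `δ`, the values at `1` and `u` of a unary
  -- polynomial.
  rw [← adjoin_eq h hu hu'] at hab hcd
  choose f hf hfa hfb using hab
  choose g hg hgc hgd using hcd
  set T : Q → Q → Q := fun x y => t.eval (Sum.elim (fun i => f i x) (fun j => g j y)) with hT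
  have hTp : IsPoly₂ T := by
    have := IsPoly.eval (n := 2)
      (F := Sum.elim (fun i x => f i (x 0)) (fun j x => g j (x 1))) (fun i => by
        rcases i with i | i
        · exact (hf i).comp (IsPoly.proj 0)
        · exact (hg i).comp (IsPoly.proj 1)) t
    unfold IsPoly₂
    convert this using 3 with x
    funext i
    rcases i with i | i <;> rfl
  have hTr : ∀ {x y : Q} {a : Fin m → Q} {c : Fin n → Q}, (∀ i, δ.r (f i x) (a i)) →
      (∀ j, δ.r (g j y) (c j)) → δ.r (T x y) (t.eval (Sum.elim a c)) := by
    intro x y a c ha hc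
    refine δ.eval_rel (fun i => ?_) t
    rcases i with i | i
    · exact ha i
    · exact hc i
  -- A second difference of `T`: it is `1` on both axes, and measures how far `T` violates the term
  -- condition at `(u, u)`.
  set p : Q → Q → Q := fun x y => rdiv (rdiv (T x y) (T x 1)) (rdiv (T 1 y) (T 1 1)) with hp
  have hpp : IsPoly₂ p :=
    ((hTp.comp (.proj 0) (.proj 1)).rdiv (hTp.comp (.proj 0) (.const 1))).rdiv
      ((hTp.comp (.const 1) (.proj 1)).rdiv (hTp.comp (.const 1) (.const 1)))
  have hp0 : ∀ y, p 1 y = 1 := fun y => rdiv_self _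
  have hp1 : ∀ x, p x 1 = 1 := fun x => by simp only [hp, rdiv_self]
  have hv : β.r 1 (p u u) := by
    have : IsPoly₁ (p u) := hpp.comp (.const u) (.proj 0)
    have := this.rel β hu
    rwa [hp1] at this
  have hv' : ¬ δ.r 1 (p u u) := by
    intro hcon
    have e1 : δ.r (T 1 1) (T 1 u) :=
      δ.iseqv.trans (hTr hfa hgc) (δ.iseqv.trans h1 (δ.iseqv.symm (hTr hfa hgd)))
    have e2 : δ.r (T u u) (T u 1) := by
      rw [← proj_eq_iff] at hcon e1 ⊢
      simp only [hp, map_rdiv, map_one, e1, rdiv_self, rdiv_one] at hcon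
      exact rdiv_eq_one_iff.1 hcon.symm
    exact h2 (δ.iseqv.trans (δ.iseqv.symm (hTr hfb hgc))
      (δ.iseqv.trans (δ.iseqv.symm e2) (hTr hfb hgd)))
  obtain ⟨k, hk, hk1, hku⟩ := exists_isPoly₁ h hv hv' hu
  refine ⟨fun x y => k (p x y), u, hk.comp hpp, hu', fun y => ?_, fun x => ?_, hku⟩
  · simp only [hp0, hk1]
  · simp only [hp1, hk1]

/-- The diagonal `d` of the conjunction fixes `u` only up to `δ`. A repetition in the orbit of `u`
supplies a truth value that is fixed exactly. -/
theorem booleanComplete_of_not_centralizes [Finite Q] {δ β : LoopCon Q} (h : δ ⋖ β)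
    (hC : ¬ Centralizes β β δ) : BooleanComplete Q := by
  obtain ⟨p, u, hp, hu, hp0, hp1, hpu⟩ := exists_and_of_not_centralizes h hC
  set d : Q → Q := fun x => p x x with hd
  have hdp : IsPoly₁ d := hp.comp (.proj 0) (.proj 0)
  have hiter : ∀ k, δ.r (d^[k] u) u := by
    intro k
    induction k with
    | zero => exact δ.iseqv.refl _
    | succ k ih =>
      rw [Function.iterate_succ_apply']
      exact δ.iseqv.trans (hdp.rel δ ih) hpu
  obtain ⟨i, j, hij, heq⟩ : ∃ i j : ℕ, i < j ∧ d^[i] u = d^[j] u := by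
    obtain ⟨i, j, hne, heq⟩ := Finite.exists_ne_map_eq_of_infinite fun k : ℕ => d^[k] u
    rcases hne.lt_or_gt with h | h
    · exact ⟨i, j, h, heq⟩
    · exact ⟨j, i, h, heq.symm⟩
  have hone : ∀ k, d^[k] 1 = 1 := fun k => Function.iterate_fixed (f := d) (hp0 1) k
  -- At `(e, e)` the polynomial `p` itself is one application of `d`, so `j - i - 1` more lead from
  -- `d^[i] u` to `d^[j] u`, which equals it.
  refine booleanComplete_of_and (p := fun x y => d^[j - i - 1] (p x y)) (e := d^[i] u)
    ((hdp.iterate _).comp hp) ?_ ?_ ?_ ?_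
  · intro hcon
    have := hiter i
    rw [hcon] at this
    exact hu this
  · intro y
    simp only [hp0, hone]
  · intro x
    simp only [hp1, hone]
  · change d^[j - i - 1] (d (d^[i] u)) = _
    rw [← Function.iterate_succ_apply, ← Function.iterate_add_apply, heq]
    congr 1
    omega

end Finite

/-! ### Normal subloops and congruences -/

namespace NormalSubloop

variable {Q : Type u} [Loop Q]

theorem con_ofCon (c : LoopCon Q) : (ofCon c).con = c := by
  apply LoopCon.r_injective
  funext x y
  exact propext ((mem_ofCon c _).trans c.rel_iff_rdiv.symm)

theorem ofCon_con (A : NormalSubloop Q) : ofCon A.con = A := by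
  ext x
  rw [mem_ofCon]
  change rdiv x 1 ∈ A.carrier ↔ _
  rw [rdiv_one]

theorem trivial_con_iff {x y : Q} : (trivial Q).con.r x y ↔ x = y := rdiv_eq_one_iff

/-- The commutator satisfies the term condition itself and is the least congruence to do so. -/
theorem abelianIn_iff (A : NormalSubloop Q) :
    A.AbelianIn ↔ LoopCon.Centralizes A.con A.con (trivial Q).con := by
  constructor
  · intro h
    have h1 : LoopCon.commutator A.con A.con = (trivial Q).con := by
      rw [← h, commutator, con_ofCon]
    rw [← h1]
    exact LoopCon.centralizes_commutator _ _
  · intro h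
    ext x
    refine (mem_ofCon _ x).trans ⟨fun hx => ?_, fun hx => ?_⟩
    · exact trivial_con_iff.1 (hx _ h)
    · have : x = 1 := hx
      rw [this]

theorem factor_con_iff {A B : NormalSubloop Q} (h : A ≤ B) {x y : Q} :
    (factor h).con.r (A.con.proj x) (A.con.proj y) ↔ B.con.r x y := by
  change rdiv (A.con.proj x) (A.con.proj y) ∈ (factor h).carrier ↔ _
  rw [← map_rdiv, LoopCon.rel_iff_rdiv]
  exact B.con.proj_eq_iff (y := 1)

/-- A factor `B / A` is abelian in `Q / A` if and only if the congruence of `B` centralizes itself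
modulo the congruence of `A`. -/
theorem factor_abelianIn_iff {A B : NormalSubloop Q} (h : A ≤ B) :
    (factor h).AbelianIn ↔ LoopCon.Centralizes B.con B.con A.con := by
  rw [abelianIn_iff]
  have hev : ∀ {m n : ℕ} (t : LoopTerm (Fin m ⊕ Fin n)) (a : Fin m → Q) (c : Fin n → Q),
      A.con.proj (t.eval (Sum.elim a c)) = t.eval (Sum.elim (A.con.proj ∘ a) (A.con.proj ∘ c)) := by
    intro m n t a c
    rw [LoopTerm.map_eval, Sum.comp_elim]
  constructor
  · intro hc m n t a b c d hab hcd ht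
    rw [← LoopCon.proj_eq_iff, hev, hev] at ht ⊢
    exact trivial_con_iff.1 (hc m n t _ _ _ _ (fun i => (factor_con_iff h).2 (hab i))
      (fun i => (factor_con_iff h).2 (hcd i)) (trivial_con_iff.2 ht))
  · intro hc m n t a b c d hab hcd ht
    have hl : ∀ {k : ℕ} (a : Fin k → A.Quo), ∃ a' : Fin k → Q, A.con.proj ∘ a' = a := fun a =>
      ⟨fun i => (A.con.proj_surjective (a i)).choose,
        funext fun i => (A.con.proj_surjective (a i)).choose_spec⟩
    obtain ⟨a, rfl⟩ := hl a
    obtain ⟨b, rfl⟩ := hl b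
    obtain ⟨c, rfl⟩ := hl c
    obtain ⟨d, rfl⟩ := hl d
    rw [trivial_con_iff, ← hev, ← hev, LoopCon.proj_eq_iff] at ht ⊢
    exact hc m n t a b c d (fun i => (factor_con_iff h).1 (hab i))
      (fun i => (factor_con_iff h).1 (hcd i)) ht

theorem le_of_con_le {δ β : LoopCon Q} (h : δ ≤ β) : ofCon δ ≤ ofCon β := fun x hx =>
  (mem_ofCon β x).2 (h _ _ ((mem_ofCon δ x).1 hx))

end NormalSubloop

/-! ### Solvable series and the two implications -/

open NormalSubloop LoopCon

/-- The series is built by well-founded induction on its top `β`, extending a series for a lower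
cover of `β`. -/
theorem congruenceSolvable_of_centralizes {Q : Type u} [Loop Q] [Finite Q]
    (H : ∀ δ β : LoopCon Q, δ ⋖ β → Centralizes β β δ) : CongruenceSolvable Q := by
  suffices hs : ∀ β : LoopCon Q, ∃ (n : ℕ) (A : ℕ → NormalSubloop Q),
      A 0 = NormalSubloop.trivial Q ∧ A n = ofCon β ∧
        ∀ i < n, ∃ h : A i ≤ A (i + 1), (factor h).AbelianIn by
    have h := hs (whole Q).con
    rwa [ofCon_con] at h
  intro β
  induction β using WellFoundedLT.induction with
  | ind β ih =>
    have hle : (NormalSubloop.trivial Q).con ≤ β := fun x y hxy => by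
      rw [trivial_con_iff.1 hxy]
    rcases hle.eq_or_lt with heq | hlt
    · refine ⟨0, fun _ => NormalSubloop.trivial Q, rfl, ?_, by simp⟩
      rw [← heq, ofCon_con]
    · obtain ⟨δ, -, hδ⟩ := exists_le_covBy_of_lt hlt
      obtain ⟨n, A, hA0, hAn, hA⟩ := ih δ hδ.lt
      have hlast : ∃ h : ofCon δ ≤ ofCon β, (factor h).AbelianIn := by
        refine ⟨le_of_con_le hδ.le, ?_⟩
        rw [factor_abelianIn_iff, con_ofCon, con_ofCon]
        exact H δ β hδ
      refine ⟨n + 1, fun i => if i ≤ n then A i else ofCon β, by simpa using hA0, by simp, ?_⟩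
      intro i hi
      rcases (Nat.lt_succ_iff.1 hi).lt_or_eq with hi | rfl
      · beta_reduce
        rw [if_pos hi.le, if_pos (Nat.succ_le_of_lt hi)]
        exact hA i hi
      · beta_reduce
        rw [if_pos le_rfl, if_neg (Nat.not_succ_le_self _), hAn]
        exact hlast

/-- An abelian congruence admits no polynomial conjunction on a pair of its elements. -/
theorem LoopCon.rel_of_centralizes_of_and {Q : Type u} [Loop Q] {β δ : LoopCon Q}
    (hC : Centralizes β β δ) {p : LoopPoly Q 2} {u v : Q} (huv : β.r u v)
    (h00 : p.value ![u, u] = u) (h01 : p.value ![u, v] = u) (h10 : p.value ![v, u] = u)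
    (h11 : p.value ![v, v] = v) : δ.r u v := by
  obtain ⟨m, s, g, rfl⟩ := LoopTerm.exists_fin p
  -- Constants and the first variable of `p` form the first block, and the second variable is the
  -- second block. The argument `y` of `val` is filler that `pos` never reads.
  let val (x y : Q) : Fin m → Q := fun i => Sum.elim id ![x, y] (g i)
  let pos : Fin m → Fin m ⊕ Fin 1 := fun i =>
    Sum.elim (fun _ => Sum.inl i) ![Sum.inl i, Sum.inr 0] (g i)
  have hval : ∀ x y : Q, (s.map pos).eval (Sum.elim (val x u) fun _ => y) =
      LoopPoly.value (s.map g) ![x, y] := by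
    intro x y
    rw [LoopPoly.value, LoopTerm.eval_map, LoopTerm.eval_map]
    congr 1
    funext i
    simp only [Function.comp, pos, val]
    rcases hgi : g i with q | j
    · simp [hgi]
    · fin_cases j <;> simp [hgi]
  -- Conjunction is constant on the row of `u` but takes the values `u` and `v` on the row of `v`.
  have key := hC m 1 (s.map pos) (val u u) (val v u) (fun _ => u) (fun _ => v)
    (fun i => by
      simp only [val]
      rcases g i with q | j
      · exact β.iseqv.refl _
      · fin_cases j
        · exact huv
        · exact β.iseqv.refl _)
    (fun _ => huv)
  rw [hval, hval, hval, hval, h00, h01, h10, h11] at key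
  exact key (δ.iseqv.refl u)

/-- Going up the series, no abelian factor can merge the two truth values, yet the last congruence
merges all elements. -/
theorem not_congruenceSolvable_of_booleanComplete {Q : Type u} [Loop Q] (hQ : BooleanComplete Q) :
    ¬ CongruenceSolvable Q := by
  obtain ⟨e, hne, he⟩ := hQ
  rintro ⟨n, A, hA0, hAn, hA⟩
  obtain ⟨p, hp⟩ := he 2 fun x => x 0 && x 1
  have hp' : ∀ a b : Bool, p.value ![e a, e b] = e (a && b) := fun a b => by
    rw [show ![e a, e b] = fun i => e (![a, b] i) by funext i; fin_cases i <;> rfl]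
    exact hp ![a, b]
  have hk : ∀ k ≤ n, ¬ (A k).con.r (e false) (e true) := by
    intro k
    induction k with
    | zero =>
      intro _
      rwa [hA0, trivial_con_iff]
    | succ k ih =>
      intro hkn hrel
      obtain ⟨h, hab⟩ := hA k hkn
      exact ih (Nat.le_of_succ_le hkn) (rel_of_centralizes_of_and
        ((factor_abelianIn_iff h).1 hab) hrel (hp' _ _) (hp' _ _) (hp' _ _) (hp' _ _))
  refine hk n le_rfl ?_
  rw [hAn]
  change _ ∈ (whole Q).carrier
  rw [carrier_whole]
  exact Set.mem_univ _

end Loop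

theorem mainTheorem4 (Q : Type*) [Loop Q] :
    (Loop.BooleanComplete Q → ¬ Loop.CongruenceSolvable Q) ∧
      (Finite Q → (Loop.BooleanComplete Q ↔ ¬ Loop.CongruenceSolvable Q)) := by
  refine ⟨Loop.not_congruenceSolvable_of_booleanComplete, fun _ =>
    ⟨Loop.not_congruenceSolvable_of_booleanComplete, fun h => ?_⟩⟩
  by_contra hQ
  refine h (Loop.congruenceSolvable_of_centralizes fun δ β hδ => ?_)
  by_contra hC
  exact hQ (Loop.booleanComplete_of_not_centralizes hδ hC)
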